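/- Let $M$ be a closed manifold, i.e. a compact connected boundaryless smooth manifold of positive dimension equipped with a Riemannian metric; let $\|\cdot\|$ be the induced norm on $TM$ and $d$ the induced distance on $M$. Let $X\neq 0$ be a $C^1$ vector field on $M$ with flow $(\varphi_t)_{t\in\mathbb R}$, and let $Sing(X)=\{x\in M: X(x)=0\}$. Suppose that (a) $X$ is k*-expansive: for every $\epsilon>0$ there is $\delta>0$ such that if $x,y\in M$ and an increasing homeomorphism $h:\mathbb R\to\mathbb R$ with $h(0)=0$ satisfy $d(\varphi_s(x),\varphi_{h(s)}(y))\le\delta$ for all $s\in\mathbb R$, then $\varphi_{h(s_0)}(y)\in\varphi_{[s_0-\epsilon,s_0+\epsilon]}(x)$ for some $s_0\in\mathbb R$; (b) $Sing(X)$ is dynamically isolated: there is a neighborhood $U$ of $Sing(X)$ with $\bigcap_{t\in\mathbb R}\varphi_t(U)=Sing(X)$. For $t\ge 0$ let $v(t)$ be the number of periodic orbits of $X$ of period at most $t$, where $x$ is periodic if there is a minimal $T>0$ with $\varphi_T(x)=x$, the period of its orbit (so singularities are not counted). Then $$\limsup_{t\to\infty}\frac1t\log v(t)\le e^*(X),$$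 where $\log 0=-\infty$ and $e^*(X)$ is the rescaled topological entropy $$e^*(X)=\lim_{\epsilon\to0^+}\ \limsup_{t\to\infty}\frac1t\log R^*(t,\epsilon).$$ Here $R^*(t,\epsilon)$ is the minimal cardinality of a set $F\subset M\setminus Sing(X)$ such that every $y\in M$ with $\|X(y)\|\ge\epsilon$ satisfies $$\sup_{0\le s\le t}\frac{d(\varphi_s(x),\varphi_s(y))}{\|X(\varphi_s(x))\|}<\epsilon\quad\text{for some }x\in F.$$ -/

import Mathlib

open Set Filter Topology Manifold Bundle
open scoped ContDiff ENNReal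

namespace RescaledFlow

section Flow

/-! ### The flow of a `C^1` vector field on a closed manifold -/

variable {E : Type*} [NormedAddCommGroup E] [NormedSpace ℝ E]
  {M : Type*} [TopologicalSpace M] [ChartedSpace E M]

open Classical in
/-- The flow `φ_t(x)` generated by the vector field `X`: `t ↦ flow X t x` is the integral curve of
`X` defined on all of `ℝ` that starts at `x`. It exists and is unique when `X` is `C^1` and `M` is
a compact Hausdorff manifold, see `flow_zero`, `isMIntegralCurve_flow` and `flow_unique` (the value
in the absence of such a curve is irrelevant). -/
noncomputable def flow (X : ∀ x : M, TangentSpace 𝓘(ℝ, E) x) (t : ℝ) (x : M) : M :=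
  if h : ∃ γ : ℝ → M, γ 0 = x ∧ IsMIntegralCurve γ X then h.choose t else x

theorem flow_zero (X : ∀ x : M, TangentSpace 𝓘(ℝ, E) x) (x : M) : flow X 0 x = x := by
  unfold flow
  split_ifs with h
  · exact h.choose_spec.1
  · rfl

/-- Integral curves starting near `x₀` live for a uniform time. -/
theorem exists_uniform_isMIntegralCurveOn [CompleteSpace E] [IsManifold 𝓘(ℝ, E) 1 M]
    {X : ∀ x : M, TangentSpace 𝓘(ℝ, E) x}
    (hX : ContMDiff 𝓘(ℝ, E) 𝓘(ℝ, E).tangent 1 (fun x => (⟨x, X x⟩ : TangentBundle 𝓘(ℝ, E) M)))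
    (x₀ : M) :
    ∃ ε > (0 : ℝ), ∀ᶠ x in 𝓝 x₀, ∃ γ : ℝ → M, γ 0 = x ∧ IsMIntegralCurveOn γ X (Ioo (-ε) ε) := by
  have hv := hX x₀
  rw [contMDiffAt_iff] at hv
  obtain ⟨_, hv⟩ := hv
  have hx : 𝓘(ℝ, E).IsInteriorPoint x₀ := BoundarylessManifold.isInteriorPoint
  obtain ⟨ε, hε, a, r, L, K, hr, hpl⟩ := IsPicardLindelof.of_contDiffAt_one
    (hv.contDiffAt (range_mem_nhds_isInteriorPoint hx)).snd
  obtain ⟨α, hα, hαc⟩ := (hpl 0).exists_forall_mem_closedBall_eq_hasDerivWithinAt_continuousOn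
  set e := extChartAt 𝓘(ℝ, E) x₀ with he
  have htgt : IsOpen e.target := isOpen_extChartAt_target x₀
  have hcont : ContinuousAt α (e x₀, 0) := by
    refine hαc.continuousAt ?_
    refine prod_mem_nhds (Metric.closedBall_mem_nhds _ hr) (Icc_mem_nhds ?_ ?_) <;> linarith
  have hα0 : α (e x₀, 0) = e x₀ := (hα (e x₀) (Metric.mem_closedBall_self r.2)).1
  have hnhds : ∀ᶠ p in 𝓝 (e x₀) ×ˢ 𝓝 (0 : ℝ), α p ∈ e.target := by
    rw [← nhds_prod_eq]
    refine hcont.eventually (htgt.mem_nhds ?_)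
    rw [hα0]
    exact mem_extChartAt_target x₀
  obtain ⟨P, hP, Q, hQ, hPQ⟩ := eventually_prod_iff.1 hnhds
  obtain ⟨η, hη, hηQ⟩ := Metric.eventually_nhds_iff_ball.1 hQ
  refine ⟨min ε η, lt_min hε hη, ?_⟩
  have h1 : ∀ᶠ x in 𝓝 x₀, P (e x) := (continuousAt_extChartAt x₀).eventually hP
  have h2 : ∀ᶠ x in 𝓝 x₀, e x ∈ Metric.closedBall (e x₀) r :=
    (continuousAt_extChartAt x₀).eventually (Metric.closedBall_mem_nhds _ hr)
  filter_upwards [h1, h2, extChartAt_source_mem_nhds (I := 𝓘(ℝ, E)) x₀] with x hx1 hx2 hx3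
  refine ⟨fun t => e.symm (α (e x, t)), ?_, ?_⟩
  · change e.symm (α (e x, 0)) = x
    rw [(hα (e x) hx2).1]
    exact e.left_inv hx3
  intro t ht
  have htε : t ∈ Ioo (0 - ε) (0 + ε) :=
    ⟨by linarith [ht.1, min_le_left ε η], by linarith [ht.2, min_le_left ε η]⟩
  have htη : t ∈ Metric.ball (0 : ℝ) η := by
    rw [Metric.mem_ball, Real.dist_eq, sub_zero, abs_lt]
    exact ⟨by linarith [ht.1, min_le_right ε η], by linarith [ht.2, min_le_right ε η]⟩
  set f : ℝ → E := fun t => α (e x, t) with hf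
  let xₜ : M := e.symm (f t)
  have h : HasDerivAt f (x := t) <| fderivWithin ℝ (e ∘ (extChartAt 𝓘(ℝ, E) xₜ).symm)
    (range 𝓘(ℝ, E)) (extChartAt 𝓘(ℝ, E) xₜ xₜ) (X xₜ) :=
    ((hα (e x) hx2).2 t (Ioo_subset_Icc_self htε)).hasDerivAt (Icc_mem_nhds htε.1 htε.2)
  rw [← tangentCoordChange_def] at h
  have hf3' : f t ∈ e.target := hPQ hx1 (hηQ t htη)
  have hft1 := mem_preimage.mp <| mem_of_mem_of_subset hf3' e.target_subset_preimage_source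
  have hft2 := mem_extChartAt_source (I := 𝓘(ℝ, E)) xₜ
  have key : HasFDerivAt (extChartAt 𝓘(ℝ, E) xₜ ∘ e.symm)
      (tangentCoordChange 𝓘(ℝ, E) x₀ xₜ xₜ) (f t) := by
    apply HasFDerivWithinAt.hasFDerivAt (s := range 𝓘(ℝ, E)) _ <| by simp
    rw [← e.right_inv hf3']
    exact hasFDerivWithinAt_tangentCoordChange ⟨hft1, hft2⟩
  have hback (w : E) : tangentCoordChange 𝓘(ℝ, E) x₀ xₜ xₜ
      (tangentCoordChange 𝓘(ℝ, E) xₜ x₀ xₜ w) = w := by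
    rw [tangentCoordChange_comp ⟨⟨hft2, hft1⟩, hft2⟩, tangentCoordChange_self hft2]
  have h' := (key.comp_hasDerivAt t h).congr_deriv (hback (X xₜ))
  have h2 := h'.hasFDerivAt.hasFDerivWithinAt (s := univ)
  apply HasMFDerivAt.hasMFDerivWithinAt
  refine ⟨(continuousAt_extChartAt_symm'' hf3').comp h.continuousAt, ?_⟩
  simp only [mfld_simps]
  exact h2

variable [CompleteSpace E] [IsManifold 𝓘(ℝ, E) 1 M] [T2Space M]
  {X : ∀ x : M, TangentSpace 𝓘(ℝ, E) x}

theorem exists_global_isMIntegralCurve [CompactSpace M]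
    (hX : ContMDiff 𝓘(ℝ, E) 𝓘(ℝ, E).tangent 1 (fun x => (⟨x, X x⟩ : TangentBundle 𝓘(ℝ, E) M)))
    (x : M) : ∃ γ : ℝ → M, γ 0 = x ∧ IsMIntegralCurve γ X := by
  choose ε hε hU using exists_uniform_isMIntegralCurveOn hX
  obtain ⟨s, hs⟩ := isCompact_univ.elim_nhds_subcover
    (fun y => {z | ∃ γ : ℝ → M, γ 0 = z ∧ IsMIntegralCurveOn γ X (Ioo (-ε y) (ε y))})
    (fun y _ => hU y)
  have hne : s.Nonempty := by
    rcases s.eq_empty_or_nonempty with h | h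
    · subst h
      simpa using hs.2 (mem_univ x)
    · exact h
  refine exists_isMIntegralCurve_of_isMIntegralCurveOn hX (ε := s.inf' hne ε)
    ((Finset.lt_inf'_iff hne).2 fun y _ => hε y) (fun z => ?_) x
  obtain ⟨y, hy, γ, hγ0, hγ⟩ := mem_iUnion₂.1 (hs.2 (mem_univ z))
  have hle := Finset.inf'_le ε hy
  exact ⟨γ, hγ0, hγ.mono (Ioo_subset_Ioo (neg_le_neg hle) hle)⟩

theorem isMIntegralCurve_flow [CompactSpace M]
    (hX : ContMDiff 𝓘(ℝ, E) 𝓘(ℝ, E).tangent 1 (fun x => (⟨x, X x⟩ : TangentBundle 𝓘(ℝ, E) M)))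
    (x : M) : IsMIntegralCurve (fun t => flow X t x) X := by
  have h := exists_global_isMIntegralCurve hX x
  have : (fun t => flow X t x) = h.choose := by
    funext t
    simp only [flow, dif_pos h]
  rw [this]
  exact h.choose_spec.2

theorem flow_unique [CompactSpace M]
    (hX : ContMDiff 𝓘(ℝ, E) 𝓘(ℝ, E).tangent 1 (fun x => (⟨x, X x⟩ : TangentBundle 𝓘(ℝ, E) M)))
    {γ : ℝ → M} (hγ : IsMIntegralCurve γ X) : γ = fun t => flow X t (γ 0) :=
  isMIntegralCurve_Ioo_eq_of_contMDiff_boundaryless (t₀ := 0) hX hγ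
    (isMIntegralCurve_flow hX (γ 0)) (flow_zero X (γ 0)).symm

end Flow

section Orbits

/-! ### Singularities, periodic orbits, dynamical isolation -/

variable {E : Type*} [NormedAddCommGroup E] [NormedSpace ℝ E]
  {M : Type*} [TopologicalSpace M] [ChartedSpace E M]

/-- The set `Sing(X)` of singularities (zeros) of `X`. -/
def singSet (X : ∀ x : M, TangentSpace 𝓘(ℝ, E) x) : Set M := {x | X x = 0}

/-- `Λ` is dynamically isolated: some neighborhood `U` of `Λ` satisfies
`⋂_{t ∈ ℝ} φ_t(U) = Λ`. -/
def IsDynamicallyIsolated (X : ∀ x : M, TangentSpace 𝓘(ℝ, E) x) (Λ : Set M) : Prop :=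
  ∃ U ∈ 𝓝ˢ Λ, ⋂ t : ℝ, flow X t '' U = Λ

/-- `x` is a periodic point of period `T`: `T` is the minimal `s > 0` with `φ_s(x) = x`
(in particular singularities are not periodic points). -/
def HasPeriod (X : ∀ x : M, TangentSpace 𝓘(ℝ, E) x) (x : M) (T : ℝ) : Prop :=
  IsLeast {s : ℝ | 0 < s ∧ flow X s x = x} T

/-- The set of periodic orbits (as subsets of `M`) of period at most `t`. -/
def periodicOrbits (X : ∀ x : M, TangentSpace 𝓘(ℝ, E) x) (t : ℝ) : Set (Set M) :=
  {O | ∃ x T, HasPeriod X x T ∧ T ≤ t ∧ O = range fun s : ℝ => flow X s x}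

/-- `v(t)`, the number of periodic orbits of period at most `t`. -/
noncomputable def numPeriodicOrbits (X : ∀ x : M, TangentSpace 𝓘(ℝ, E) x) (t : ℝ) : ℕ∞ :=
  (periodicOrbits X t).encard

/-- `limsup_{t → ∞} (1/t) log a(t)`, an extended real number (with `log 0 = -∞`). -/
noncomputable def growthRate (a : ℝ → ℕ∞) : EReal :=
  limsup (fun t : ℝ => ENNReal.log (a t : ℝ≥0∞) / (t : EReal)) atTop

end Orbits

section Entropy

/-! ### `k*`-expansivity and rescaled topological entropy -/

variable {E : Type*} [NormedAddCommGroup E] [NormedSpace ℝ E]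
  {M : Type*} [MetricSpace M] [ChartedSpace E M]

/-- `X` is `k*`-expansive. An increasing homeomorphism of `ℝ` is an order isomorphism `ℝ ≃o ℝ`. -/
def IsKStarExpansive (X : ∀ x : M, TangentSpace 𝓘(ℝ, E) x) : Prop :=
  ∀ ε : ℝ, 0 < ε → ∃ δ : ℝ, 0 < δ ∧ ∀ (x y : M) (h : ℝ ≃o ℝ), h 0 = 0 →
    (∀ s : ℝ, dist (flow X s x) (flow X (h s) y) ≤ δ) →
    ∃ s₀ : ℝ, flow X (h s₀) y ∈ (fun s => flow X s x) '' Icc (s₀ - ε) (s₀ + ε)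

variable [RiemannianBundle (fun x : M => TangentSpace 𝓘(ℝ, E) x)]

/-- `d*_t(x, y) = sup_{0 ≤ s ≤ t} d(φ_s(x), φ_s(y)) / ‖X(φ_s(x))‖` (used for `X x ≠ 0`), with values
in `[0, ∞]`. -/
noncomputable def rescaledDist (X : ∀ x : M, TangentSpace 𝓘(ℝ, E) x) (t : ℝ) (x y : M) : ℝ≥0∞ :=
  ⨆ s ∈ Icc 0 t, ENNReal.ofReal (dist (flow X s x) (flow X s y) / ‖X (flow X s x)‖)

/-- The rescaled dynamical ball `B*(x, t, ε)`. -/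
def rescaledBall (X : ∀ x : M, TangentSpace 𝓘(ℝ, E) x) (x : M) (t ε : ℝ) : Set M :=
  {y | rescaledDist X t x y < ENNReal.ofReal ε}

/-- `F` is a rescaled `(t, ε)`-spanning set: `F ⊆ M ∖ Sing(X)` and the balls `B*(x, t, ε)`, `x ∈ F`,
cover `M_ε = {x | ‖X(x)‖ ≥ ε}`. -/
def IsRescaledSpanning (X : ∀ x : M, TangentSpace 𝓘(ℝ, E) x) (t ε : ℝ) (F : Set M) : Prop :=
  F ⊆ (singSet X)ᶜ ∧ {x : M | ε ≤ ‖X x‖} ⊆ ⋃ x ∈ F, rescaledBall X x t ε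

/-- `R*(t, ε)`, the minimal cardinality of a rescaled `(t, ε)`-spanning set. -/
noncomputable def rescaledSpanningNumber (X : ∀ x : M, TangentSpace 𝓘(ℝ, E) x) (t ε : ℝ) : ℕ∞ :=
  ⨅ (F : Set M) (_ : IsRescaledSpanning X t ε F), F.encard

/-- The rescaled topological entropy
`e*(X) = lim_{ε → 0⁺} limsup_{t → ∞} (1/t) log R*(t, ε)`. The limit always exists, see
`tendsto_rescaledEntropy`. -/
noncomputable def rescaledEntropy (X : ∀ x : M, TangentSpace 𝓘(ℝ, E) x) : EReal :=
  limUnder (𝓝[>] (0 : ℝ)) fun ε => growthRate fun t => rescaledSpanningNumber X t ε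

theorem rescaledSpanningNumber_antitone (X : ∀ x : M, TangentSpace 𝓘(ℝ, E) x) (t : ℝ) :
    Antitone fun ε => rescaledSpanningNumber X t ε := by
  intro ε ε' hle
  refine le_iInf₂ fun F hF => iInf₂_le_of_le F ⟨hF.1, fun x hx => ?_⟩ le_rfl
  obtain ⟨z, hz, hxz⟩ := mem_iUnion₂.1 (hF.2 (hle.trans hx))
  exact mem_iUnion₂.2 ⟨z, hz, lt_of_lt_of_le hxz (ENNReal.ofReal_le_ofReal hle)⟩

theorem tendsto_rescaledEntropy (X : ∀ x : M, TangentSpace 𝓘(ℝ, E) x) :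
    Tendsto (fun ε => growthRate fun t => rescaledSpanningNumber X t ε) (𝓝[>] (0 : ℝ))
      (𝓝 (rescaledEntropy X)) := by
  refine tendsto_nhds_limUnder ⟨_, Antitone.tendsto_nhdsGT ?_ 0⟩
  intro ε ε' hle
  refine limsup_le_limsup ?_
  filter_upwards [eventually_gt_atTop (0 : ℝ)] with t ht
  refine EReal.div_le_div_right_of_nonneg (by exact_mod_cast ht.le) (ENNReal.log_monotone ?_)
  exact_mod_cast rescaledSpanningNumber_antitone X t hle

end Entropy

end RescaledFlow

/-!
Periodic orbits of a `k*`-expansive flow are counted by a spanning set.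

Fix `δ` as in `k*`-expansivity and let `C` bound `‖X‖`. Integral curves have speed at most `C`, so
they are `C`-Lipschitz for the Riemannian distance (`dist_le_of_isMIntegralCurve`). Suppose that two
periodic orbits have periods `T`, `T'` with `|T' - T| ≤ η` and points whose orbits stay `2εC`-close
up to time `T`. The linear time change `s ↦ (T' / T) s` costs at most `Cη` over one period and
makes both motions return simultaneously, so they remain `2εC + Cη`-close for all times. If this is
at most `δ`, the orbits coincide (`range_flow_eq_of_dist_le`).

Dynamical isolation of `Sing(X)` forces every regular orbit to leave a fixed neighborhood of
`Sing(X)` (`exists_flow_notMem`), hence, by compactness, to pass through a point with `‖X‖ ≥ ε`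
once `ε` is small. That point lies in a rescaled ball centered at an element of any rescaled
`(t, ε)`-spanning set. Two orbits of period at most `t` that use the same center, and whose periods
have the same integer part in units of `η`, coincide, so
`v(t) ≤ (⌊t / η⌋ + 1) R*(t, ε)` (`numPeriodicOrbits_le_floor_mul_encard`). The linear factor does
not affect exponential growth (`growthRate_le_of_le_floor_mul`), and `ε → 0⁺` gives the result.
-/

namespace RescaledFlow

section Geometry

/-! ### Integral curves are `C^1` and Lipschitz -/

variable {E : Type*} [NormedAddCommGroup E] [NormedSpace ℝ E]

/-- In the chart at `γ t₀`, the derivative of `γ` is the fiber coordinate of `X` along `γ` in the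
trivialization of the tangent bundle at `γ t₀`, which is continuous. -/
theorem contMDiff_one_of_isMIntegralCurve {M : Type*} [TopologicalSpace M] [ChartedSpace E M]
    [IsManifold 𝓘(ℝ, E) 1 M] {X : ∀ x : M, TangentSpace 𝓘(ℝ, E) x}
    (hX : Continuous fun x => (⟨x, X x⟩ : TangentBundle 𝓘(ℝ, E) M))
    {γ : ℝ → M} (hγ : IsMIntegralCurve γ X) : ContMDiff 𝓘(ℝ, ℝ) 𝓘(ℝ, E) 1 γ := by
  intro t₀
  rw [contMDiffAt_iff_target]
  refine ⟨hγ.continuous.continuousAt, ?_⟩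
  rw [contMDiffAt_iff_contDiffAt, contDiffAt_one_iff]
  set e := trivializationAt E (TangentSpace 𝓘(ℝ, E)) (γ t₀)
  have hder := (hγ.isMIntegralCurveAt t₀).eventually_hasDerivAt
  have hbase : ∀ᶠ t in 𝓝 t₀, γ t ∈ e.baseSet :=
    hγ.continuous.continuousAt.eventually
      (e.open_baseSet.mem_nhds (FiberBundle.mem_baseSet_trivializationAt' (γ t₀)))
  have hopen : IsOpen (γ ⁻¹' e.baseSet) := e.open_baseSet.preimage hγ.continuous
  refine ⟨fun t => ContinuousLinearMap.toSpanSingleton ℝ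
      (e (⟨γ t, X (γ t)⟩ : TangentBundle 𝓘(ℝ, E) M)).2, _,
    hder.and hbase, ?_, fun t ht => ht.1.hasFDerivAt⟩
  have hc : ContinuousOn (fun t => (e (⟨γ t, X (γ t)⟩ : TangentBundle 𝓘(ℝ, E) M)).2)
      {t | γ t ∈ e.baseSet} := by
    refine continuous_snd.comp_continuousOn
      (e.continuousOn.comp (hX.comp hγ.continuous).continuousOn fun t ht => ?_)
    rw [e.source_eq]
    exact ht
  exact ((ContinuousLinearMap.toSpanSingletonCLE (𝕜 := ℝ) (E := E)).continuous.comp_continuousOn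
    hc).mono fun t ht => ht.2

variable {M : Type*} [MetricSpace M] [ChartedSpace E M]
  [RiemannianBundle (fun x : M => TangentSpace 𝓘(ℝ, E) x)]

theorem continuous_norm_of_continuous [IsManifold 𝓘(ℝ, E) 1 M]
    [IsContinuousRiemannianBundle E (fun x : M => TangentSpace 𝓘(ℝ, E) x)]
    {X : ∀ x : M, TangentSpace 𝓘(ℝ, E) x}
    (hX : Continuous fun x => (⟨x, X x⟩ : TangentBundle 𝓘(ℝ, E) M)) :
    Continuous fun x => ‖X x‖ := by
  simp_rw [norm_eq_sqrt_real_inner]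
  exact (Continuous.inner_bundle (b := id) (F := E) hX hX).sqrt

theorem dist_le_of_isMIntegralCurve [IsManifold 𝓘(ℝ, E) 1 M] [IsRiemannianManifold 𝓘(ℝ, E) M]
    {X : ∀ x : M, TangentSpace 𝓘(ℝ, E) x}
    (hX : Continuous fun x => (⟨x, X x⟩ : TangentBundle 𝓘(ℝ, E) M))
    {γ : ℝ → M} (hγ : IsMIntegralCurve γ X) {C : ℝ} (hC : ∀ x, ‖X x‖ ≤ C) (a b : ℝ) :
    dist (γ a) (γ b) ≤ C * |b - a| := by
  wlog hab : a ≤ b generalizing a b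
  · rw [dist_comm, abs_sub_comm]
    exact this b a (le_of_not_ge hab)
  have hC0 : 0 ≤ C := (norm_nonneg _).trans (hC (γ 0))
  rw [abs_of_nonneg (sub_nonneg.2 hab)]
  refine (edist_le_ofReal (mul_nonneg hC0 (sub_nonneg.2 hab))).1 ?_
  rw [IsRiemannianManifold.out (I := 𝓘(ℝ, E)) (γ a) (γ b)]
  refine (riemannianEDist_le_pathELength
    (contMDiff_one_of_isMIntegralCurve hX hγ).contMDiffOn rfl rfl hab).trans ?_
  rw [pathELength_eq_lintegral_mfderiv_Icc]
  have hd : ∀ t, ‖mfderiv 𝓘(ℝ, ℝ) 𝓘(ℝ, E) γ t 1‖ₑ ≤ ENNReal.ofReal C := by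
    intro t
    rw [(hγ t).mfderiv]
    have : ((1 : ℝ →L[ℝ] ℝ).smulRight (X (γ t)) : ℝ →L[ℝ] TangentSpace 𝓘(ℝ, E) (γ t)) 1 =
      X (γ t) := by simp
    -- the derivative lives in a type of linear maps out of `TangentSpace 𝓘(ℝ, ℝ) t`, which agrees
    -- with `ℝ` only up to unfolding
    erw [this]
    rw [← ofReal_norm]
    exact ENNReal.ofReal_le_ofReal (hC _)
  calc ∫⁻ t in Icc a b, ‖mfderiv 𝓘(ℝ, ℝ) 𝓘(ℝ, E) γ t 1‖ₑ
      ≤ ∫⁻ _ in Icc a b, ENNReal.ofReal C := MeasureTheory.lintegral_mono fun t => hd t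
    _ = ENNReal.ofReal (C * (b - a)) := by
      rw [MeasureTheory.setLIntegral_const, Real.volume_Icc, ENNReal.ofReal_mul hC0]

end Geometry

section FlowLaws

/-! ### The flow as a group action, periodic points -/

variable {E : Type*} [NormedAddCommGroup E] [NormedSpace ℝ E] [CompleteSpace E]
  {M : Type*} [TopologicalSpace M] [ChartedSpace E M] [IsManifold 𝓘(ℝ, E) 1 M] [T2Space M]
  [CompactSpace M] {X : ∀ x : M, TangentSpace 𝓘(ℝ, E) x}

theorem flow_add
    (hX : ContMDiff 𝓘(ℝ, E) 𝓘(ℝ, E).tangent 1 (fun x => (⟨x, X x⟩ : TangentBundle 𝓘(ℝ, E) M)))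
    (s t : ℝ) (x : M) : flow X (s + t) x = flow X s (flow X t x) := by
  have h := congrFun (flow_unique hX ((isMIntegralCurve_flow hX x).comp_add t)) s
  simpa using h

theorem flow_eq_self_of_mem_singSet
    (hX : ContMDiff 𝓘(ℝ, E) 𝓘(ℝ, E).tangent 1 (fun x => (⟨x, X x⟩ : TangentBundle 𝓘(ℝ, E) M)))
    {x : M} (hx : x ∈ singSet X) (t : ℝ) : flow X t x = x :=
  (congrFun (flow_unique hX (isMIntegralCurve_const hx)) t).symm

theorem HasPeriod.notMem_singSet
    (hX : ContMDiff 𝓘(ℝ, E) 𝓘(ℝ, E).tangent 1 (fun x => (⟨x, X x⟩ : TangentBundle 𝓘(ℝ, E) M)))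
    {x : M} {T : ℝ} (h : HasPeriod X x T) : x ∉ singSet X := by
  intro hx
  -- every positive time fixes a singularity, so there is no least one
  have hT := h.2 (show T / 2 ∈ {s : ℝ | 0 < s ∧ flow X s x = x} from
    ⟨half_pos h.1.1, flow_eq_self_of_mem_singSet hX hx _⟩)
  linarith [h.1.1]

theorem range_flow_flow
    (hX : ContMDiff 𝓘(ℝ, E) 𝓘(ℝ, E).tangent 1 (fun x => (⟨x, X x⟩ : TangentBundle 𝓘(ℝ, E) M)))
    (r : ℝ) (x : M) :
    (range fun s : ℝ => flow X s (flow X r x)) = range fun s : ℝ => flow X s x := by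
  simp_rw [← flow_add hX]
  exact (Equiv.addRight r).surjective.range_comp fun s => flow X s x

theorem hasPeriod_flow
    (hX : ContMDiff 𝓘(ℝ, E) 𝓘(ℝ, E).tangent 1 (fun x => (⟨x, X x⟩ : TangentBundle 𝓘(ℝ, E) M)))
    {x : M} {T : ℝ} (h : HasPeriod X x T) (r : ℝ) : HasPeriod X (flow X r x) T := by
  have key : ∀ s, flow X s (flow X r x) = flow X r x ↔ flow X s x = x := by
    intro s
    rw [← flow_add hX, add_comm s r, flow_add hX]
    refine ⟨fun hs => ?_, fun hs => by rw [hs]⟩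
    have := congrArg (flow X (-r)) hs
    simpa [← flow_add hX, flow_zero] using this
  simpa only [HasPeriod, key] using h

theorem HasPeriod.periodic
    (hX : ContMDiff 𝓘(ℝ, E) 𝓘(ℝ, E).tangent 1 (fun x => (⟨x, X x⟩ : TangentBundle 𝓘(ℝ, E) M)))
    {x : M} {T : ℝ} (h : HasPeriod X x T) : Function.Periodic (fun s => flow X s x) T :=
  fun s => by
    change flow X (s + T) x = flow X s x
    rw [flow_add hX, h.1.2]

/-- If `U` witnesses the dynamical isolation of `Sing(X)`, every regular orbit leaves `U`. -/
theorem exists_flow_notMem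
    (hX : ContMDiff 𝓘(ℝ, E) 𝓘(ℝ, E).tangent 1 (fun x => (⟨x, X x⟩ : TangentBundle 𝓘(ℝ, E) M)))
    {U : Set M} (hU : ⋂ t : ℝ, flow X t '' U = singSet X) {x : M} (hx : x ∉ singSet X) :
    ∃ r : ℝ, flow X r x ∉ U := by
  by_contra! h
  refine hx (hU ▸ mem_iInter.2 fun t => ⟨flow X (-t) x, h _, ?_⟩)
  rw [← flow_add hX, add_neg_cancel, flow_zero]

end FlowLaws

section Growth

/-! ### Exponential growth rates -/

theorem tendsto_log_floor_div_atTop {η : ℝ} (hη : 0 < η) :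
    Tendsto (fun t : ℝ => Real.log ((⌊t / η⌋₊ + 1 : ℕ) : ℝ) / t) atTop (𝓝 0) := by
  have h1 : Tendsto (fun t : ℝ => Real.log (t / η + 1) / (t / η + 1)) atTop (𝓝 0) := by
    have h := Real.isLittleO_log_id_atTop.tendsto_div_nhds_zero
    exact h.comp (tendsto_atTop_add_const_right _ _ (tendsto_id.atTop_div_const hη))
  have h2 : Tendsto (fun t : ℝ => (t / η + 1) / t) atTop (𝓝 (1 / η + 0)) := by
    refine Tendsto.congr' ?_ (tendsto_const_nhds.add tendsto_inv_atTop_zero)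
    filter_upwards [eventually_gt_atTop (0 : ℝ)] with t ht
    field_simp
  have h3 := h1.mul h2
  rw [zero_mul] at h3
  refine squeeze_zero' ?_ ?_ h3
  · filter_upwards [eventually_gt_atTop (0 : ℝ)] with t ht
    exact div_nonneg (Real.log_natCast_nonneg _) ht.le
  · filter_upwards [eventually_gt_atTop (0 : ℝ)] with t ht
    have hpos : 0 < t / η + 1 := by positivity
    rw [div_mul_div_cancel₀ hpos.ne']
    gcongr
    push_cast
    gcongr
    exact Nat.floor_le (by positivity)

/-- A factor growing linearly in `t` does not change the exponential growth rate. -/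
theorem growthRate_le_of_le_floor_mul {a b : ℝ → ℕ∞} {η : ℝ} (hη : 0 < η)
    (h : ∀ᶠ t in atTop, a t ≤ ((⌊t / η⌋₊ + 1 : ℕ) : ℕ∞) * b t) :
    growthRate a ≤ growthRate b := by
  have hN : Tendsto (fun t : ℝ => ENNReal.log (((⌊t / η⌋₊ + 1 : ℕ) : ℝ≥0∞)) / (t : EReal)) atTop
      (𝓝 0) := by
    have h0 := (continuous_coe_real_ereal.tendsto 0).comp (tendsto_log_floor_div_atTop hη)
    refine h0.congr fun t => ?_
    have hpos : (0 : ℝ) < ((⌊t / η⌋₊ + 1 : ℕ) : ℝ) := by positivity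
    rw [← ENNReal.ofReal_natCast, ENNReal.log_ofReal_of_pos hpos]
    exact EReal.coe_div _ _
  calc growthRate a
      ≤ limsup ((fun t : ℝ => ENNReal.log (((⌊t / η⌋₊ + 1 : ℕ) : ℝ≥0∞)) / (t : EReal)) +
          fun t : ℝ => ENNReal.log (b t : ℝ≥0∞) / (t : EReal)) atTop := by
        refine limsup_le_limsup ?_
        filter_upwards [h, eventually_gt_atTop (0 : ℝ)] with t ht h0
        have h0' : (0 : EReal) ≤ t := by exact_mod_cast h0.le
        have ht' : (a t : ℝ≥0∞) ≤ ((⌊t / η⌋₊ + 1 : ℕ) : ℝ≥0∞) * (b t : ℝ≥0∞) := by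
          exact_mod_cast ht
        rw [Pi.add_apply, ← EReal.add_div_of_nonneg_right h0', ← ENNReal.log_mul_add]
        exact EReal.div_le_div_right_of_nonneg h0' (ENNReal.log_monotone ht')
    _ ≤ 0 + growthRate b := by
        refine (EReal.limsup_add_le ?_ ?_).trans_eq ?_
        · left; rw [hN.limsup_eq]; simp
        · left; rw [hN.limsup_eq]; simp
        · rw [hN.limsup_eq]; rfl
    _ = growthRate b := zero_add _

end Growth

section Separation

/-! ### Separation and counting of periodic orbits -/

variable {E : Type*} [NormedAddCommGroup E] [NormedSpace ℝ E] [CompleteSpace E]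
  {M : Type*} [MetricSpace M] [ChartedSpace E M] [IsManifold 𝓘(ℝ, E) 1 M]
  [CompactSpace M] {X : ∀ x : M, TangentSpace 𝓘(ℝ, E) x}

/-- Two periodic orbits with nearly equal periods that stay close over one period coincide: the
linear time change `s ↦ (T' / T) s` matches the periods, so that closeness over one period is
closeness for all times, and `k*`-expansivity applies. -/
theorem range_flow_eq_of_dist_le
    (hX : ContMDiff 𝓘(ℝ, E) 𝓘(ℝ, E).tangent 1 (fun x => (⟨x, X x⟩ : TangentBundle 𝓘(ℝ, E) M)))
    {ε δ C : ℝ} (hC : 0 ≤ C)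
    (hδ : ∀ (x y : M) (h : ℝ ≃o ℝ), h 0 = 0 →
      (∀ s : ℝ, dist (flow X s x) (flow X (h s) y) ≤ δ) →
      ∃ s₀ : ℝ, flow X (h s₀) y ∈ (fun s => flow X s x) '' Icc (s₀ - ε) (s₀ + ε))
    (hlip : ∀ (x : M) (a b : ℝ), dist (flow X a x) (flow X b x) ≤ C * |b - a|)
    {x y : M} {T T' : ℝ} (hx : HasPeriod X x T) (hy : HasPeriod X y T')
    (hclose : ∀ s ∈ Icc 0 T, dist (flow X s x) (flow X s y) + C * |T' - T| ≤ δ) :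
    (range fun s : ℝ => flow X s x) = range fun s : ℝ => flow X s y := by
  have hT : 0 < T := hx.1.1
  have hT' : 0 < T' := hy.1.1
  have ha : 0 < T' / T := div_pos hT' hT
  obtain ⟨s₀, r, -, hr⟩ := hδ x y (OrderIso.mulRight₀ (T' / T) ha) (by simp) <| by
    intro s
    -- reduce `s` to the fundamental domain `[0, T)`; the time change maps `n T` to `n T'`
    obtain ⟨n, hn⟩ : ∃ n : ℤ, s = toIcoMod hT 0 s + n * T :=
      ⟨toIcoDiv hT 0 s, by rw [← zsmul_eq_mul, toIcoMod_add_toIcoDiv_zsmul]⟩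
    set u := toIcoMod hT 0 s
    have hu0 : 0 ≤ u := (toIcoMod_mem_Ico' hT s).1
    have huT : u < T := (toIcoMod_mem_Ico' hT s).2
    have e1 : flow X s x = flow X u x := by
      rw [hn]
      exact ((hx.periodic hX).int_mul n) u
    have e2 : flow X (s * (T' / T)) y = flow X (u * (T' / T)) y := by
      rw [show s * (T' / T) = u * (T' / T) + n * T' by rw [hn]; field_simp]
      exact ((hy.periodic hX).int_mul n) _
    have e3 : |u * (T' / T) - u| ≤ |T' - T| := by
      rw [show u * (T' / T) - u = u / T * (T' - T) by field_simp, abs_mul,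
        abs_of_nonneg (by positivity)]
      exact mul_le_of_le_one_left (abs_nonneg _) ((div_le_one hT).2 huT.le)
    rw [OrderIso.mulRight₀_apply, e1, e2]
    calc dist (flow X u x) (flow X (u * (T' / T)) y)
        ≤ dist (flow X u x) (flow X u y) + dist (flow X u y) (flow X (u * (T' / T)) y) :=
          dist_triangle _ _ _
      _ ≤ dist (flow X u x) (flow X u y) + C * |T' - T| := by
          gcongr
          exact (hlip _ _ _).trans (by gcongr)
      _ ≤ δ := hclose u ⟨hu0, huT.le⟩
  rw [← range_flow_flow hX r x, ← range_flow_flow hX _ y]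
  exact congrArg (fun z => range fun s : ℝ => flow X s z) hr

variable [RiemannianBundle (fun x : M => TangentSpace 𝓘(ℝ, E) x)]

/-- The hypothesis `z ∉ singSet X` keeps the denominators `‖X (φ_s z)‖` of the rescaled distance
away from zero, where the quotient would be the junk value `0`. -/
theorem dist_lt_of_mem_rescaledBall
    (hX : ContMDiff 𝓘(ℝ, E) 𝓘(ℝ, E).tangent 1 (fun x => (⟨x, X x⟩ : TangentBundle 𝓘(ℝ, E) M)))
    {z p : M} (hz : z ∉ singSet X) {t ε : ℝ} (hp : p ∈ rescaledBall X z t ε)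
    {s : ℝ} (hs : s ∈ Icc 0 t) :
    dist (flow X s z) (flow X s p) < ε * ‖X (flow X s z)‖ := by
  have hne : X (flow X s z) ≠ 0 := by
    intro h0
    have h1 := flow_eq_self_of_mem_singSet hX h0 (-s)
    rw [← flow_add hX, neg_add_cancel, flow_zero] at h1
    exact hz (h1 ▸ h0)
  have hlt : ENNReal.ofReal (dist (flow X s z) (flow X s p) / ‖X (flow X s z)‖) <
      ENNReal.ofReal ε :=
    lt_of_le_of_lt (le_iSup₂ (f := fun s (_ : s ∈ Icc 0 t) =>
      ENNReal.ofReal (dist (flow X s z) (flow X s p) / ‖X (flow X s z)‖)) s hs) hp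
  exact (div_lt_iff₀ (norm_pos_iff.2 hne)).1 (ENNReal.ofReal_lt_ofReal_iff'.1 hlt).1

/-- Sorting the periodic orbits by their period, up to an error `η`, and by the center of a ball of
a spanning set that contains a point of the orbit, separates them. -/
theorem numPeriodicOrbits_le_floor_mul_encard [Nonempty M]
    (hX : ContMDiff 𝓘(ℝ, E) 𝓘(ℝ, E).tangent 1 (fun x => (⟨x, X x⟩ : TangentBundle 𝓘(ℝ, E) M)))
    {ε₁ δ C η ε : ℝ} (hη : 0 < η) (hε : 0 ≤ ε) (hC : ∀ x, ‖X x‖ ≤ C)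
    (hδ : ∀ (x y : M) (h : ℝ ≃o ℝ), h 0 = 0 →
      (∀ s : ℝ, dist (flow X s x) (flow X (h s) y) ≤ δ) →
      ∃ s₀ : ℝ, flow X (h s₀) y ∈ (fun s => flow X s x) '' Icc (s₀ - ε₁) (s₀ + ε₁))
    (hlip : ∀ (x : M) (a b : ℝ), dist (flow X a x) (flow X b x) ≤ C * |b - a|)
    (hsmall : 2 * (ε * C) + C * η ≤ δ)
    (hreg : ∀ x ∉ singSet X, ∃ r : ℝ, ε ≤ ‖X (flow X r x)‖)
    {t : ℝ} {F : Set M} (hF : IsRescaledSpanning X t ε F) :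
    numPeriodicOrbits X t ≤ ((⌊t / η⌋₊ + 1 : ℕ) : ℕ∞) * F.encard := by
  have hex : ∀ O ∈ periodicOrbits X t, ∃ (p : M) (T : ℝ) (z : M), HasPeriod X p T ∧ T ≤ t ∧
      (O = range fun s : ℝ => flow X s p) ∧ z ∈ F ∧ p ∈ rescaledBall X z t ε := by
    rintro O ⟨x, T, hx, hT, rfl⟩
    obtain ⟨r, hr⟩ := hreg x (hx.notMem_singSet hX)
    obtain ⟨z, hz, hpz⟩ := mem_iUnion₂.1 (hF.2 hr)
    exact ⟨_, T, z, hasPeriod_flow hX hx r, hT, (range_flow_flow hX r x).symm, hz, hpz⟩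
  choose! p T z hper hT hO hz hball using hex
  have hmaps : MapsTo (fun O => (⌊T O / η⌋₊, z O)) (periodicOrbits X t)
      ((Finset.range (⌊t / η⌋₊ + 1) : Set ℕ) ×ˢ F) := by
    intro O h
    refine ⟨?_, hz O h⟩
    rw [Finset.coe_range, mem_Iio, Nat.lt_succ_iff]
    exact Nat.floor_le_floor (div_le_div_of_nonneg_right (hT O h) hη.le)
  have hinj : InjOn (fun O => (⌊T O / η⌋₊, z O)) (periodicOrbits X t) := by
    intro O h O' h' heq
    obtain ⟨hfl, hzz⟩ := Prod.ext_iff.1 heq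
    dsimp only at hfl hzz
    rw [hO O h, hO O' h']
    have hC0 : 0 ≤ C := (norm_nonneg _).trans (hC (p O))
    refine range_flow_eq_of_dist_le hX hC0 hδ hlip (hper O h) (hper O' h') fun s hs => ?_
    have hst : s ∈ Icc 0 t := ⟨hs.1, hs.2.trans (hT O h)⟩
    have hzs : z O ∉ singSet X := hF.1 (hz O h)
    have hεC : ε * ‖X (flow X s (z O))‖ ≤ ε * C := by gcongr; exact hC _
    have d1 := (dist_lt_of_mem_rescaledBall hX hzs (hball O h) hst).le.trans hεC
    have d2 := (dist_lt_of_mem_rescaledBall hX hzs (hzz ▸ hball O' h') hst).le.trans hεC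
    have hTT : |T O' - T O| ≤ η := by
      have a1 := Nat.floor_le (div_nonneg (hper O h).1.1.le hη.le)
      have a2 := Nat.lt_floor_add_one (T O / η)
      have b1 := Nat.floor_le (div_nonneg (hper O' h').1.1.le hη.le)
      have b2 := Nat.lt_floor_add_one (T O' / η)
      rw [← hfl] at b1 b2
      rw [le_div_iff₀ hη] at a1 b1
      rw [div_lt_iff₀ hη] at a2 b2
      rw [abs_le]
      constructor <;> nlinarith
    have := dist_triangle_left (flow X s (p O)) (flow X s (p O')) (flow X s (z O))
    have := mul_le_mul_of_nonneg_left hTT hC0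
    linarith
  calc numPeriodicOrbits X t
      ≤ ((Finset.range (⌊t / η⌋₊ + 1) : Set ℕ) ×ˢ F).encard := encard_le_encard_of_injOn hmaps hinj
    _ = ((⌊t / η⌋₊ + 1 : ℕ) : ℕ∞) * F.encard := by
      rw [encard_prod, encard_coe_eq_coe_finsetCard, Finset.card_range]

end Separation

end RescaledFlow

theorem mainTheorem2
    {E : Type*} [NormedAddCommGroup E] [NormedSpace ℝ E] [FiniteDimensional ℝ E]
    (hdim : 0 < Module.finrank ℝ E)
    {M : Type*} [MetricSpace M] [CompactSpace M] [ConnectedSpace M]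
    [ChartedSpace E M] [IsManifold 𝓘(ℝ, E) ∞ M]
    [RiemannianBundle (fun x : M => TangentSpace 𝓘(ℝ, E) x)]
    [IsContMDiffRiemannianBundle 𝓘(ℝ, E) ∞ E (fun x : M => TangentSpace 𝓘(ℝ, E) x)]
    [IsRiemannianManifold 𝓘(ℝ, E) M]
    (X : ∀ x : M, TangentSpace 𝓘(ℝ, E) x)
    (hX : ContMDiff 𝓘(ℝ, E) 𝓘(ℝ, E).tangent 1
      (fun x => (⟨x, X x⟩ : TangentBundle 𝓘(ℝ, E) M)))
    (hX0 : X ≠ 0)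
    (hexp : RescaledFlow.IsKStarExpansive X)
    (hiso : RescaledFlow.IsDynamicallyIsolated X (RescaledFlow.singSet X)) :
    RescaledFlow.growthRate (RescaledFlow.numPeriodicOrbits X) ≤
      RescaledFlow.rescaledEntropy X := by
  open RescaledFlow in
  have : CompleteSpace E := FiniteDimensional.complete ℝ E
  have : IsContinuousRiemannianBundle E (fun x : M => TangentSpace 𝓘(ℝ, E) x) :=
    ⟨by
      obtain ⟨g, hg, hgi⟩ := IsContMDiffRiemannianBundle.exists_contMDiff (IB := 𝓘(ℝ, E)) (n := ∞)
        (F := E) (E := fun x : M => TangentSpace 𝓘(ℝ, E) x)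
      exact ⟨g, hg.continuous, hgi⟩⟩
  have hcont : Continuous fun x => ‖X x‖ := continuous_norm_of_continuous hX.continuous
  obtain ⟨x₀, -, hx₀⟩ := isCompact_univ.exists_isMaxOn univ_nonempty hcont.continuousOn
  -- adding `1` makes `C` positive, so that one can divide by it below
  set C := ‖X x₀‖ + 1
  have hC : ∀ x, ‖X x‖ ≤ C := fun x => (hx₀ (mem_univ x)).trans (by linarith)
  have hCpos : 0 < C := by positivity
  have hlip : ∀ (x : M) (a b : ℝ), dist (flow X a x) (flow X b x) ≤ C * |b - a| := fun x =>
    dist_le_of_isMIntegralCurve hX.continuous (isMIntegralCurve_flow hX x) hC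
  obtain ⟨δ, hδ0, hδ⟩ := hexp 1 one_pos
  obtain ⟨U, hU, hUinv⟩ := hiso
  -- the speed is bounded below off `U`
  obtain ⟨ε₀, hε₀, hreg⟩ : ∃ ε₀ > 0, ∀ x ∉ U, ε₀ ≤ ‖X x‖ := by
    have hK : IsCompact (interior U)ᶜ := isOpen_interior.isClosed_compl.isCompact
    have hpos : ∀ x ∈ (interior U)ᶜ, 0 < ‖X x‖ := fun x hx =>
      norm_pos_iff.2 fun h0 => hx (subset_interior_iff_mem_nhdsSet.2 hU h0)
    obtain ⟨ε₀, hε₀, h⟩ := hK.exists_forall_le' hcont.continuousOn hpos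
    exact ⟨ε₀, hε₀, fun x hx => h x fun hx' => hx (interior_subset hx')⟩
  -- `C * η` uses half of `δ`; the other half is left for `2 * (ε * C)`
  set η := δ / (2 * C) with hη
  have hη0 : 0 < η := by positivity
  refine ge_of_tendsto (tendsto_rescaledEntropy X) ?_
  have hev : ∀ᶠ ε in 𝓝[>] (0 : ℝ), ε < min ε₀ (δ / (4 * C)) :=
    nhdsWithin_le_nhds (gt_mem_nhds (by positivity))
  filter_upwards [hev, self_mem_nhdsWithin] with ε hε hεpos
  refine growthRate_le_of_le_floor_mul hη0 (Eventually.of_forall fun t => ?_)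
  rw [rescaledSpanningNumber, iInf_subtype']
  rcases isEmpty_or_nonempty {F : Set M // IsRescaledSpanning X t ε F} with hem | hne
  -- without a spanning set the spanning number is `⊤`
  · simp [iInf_of_empty, ENat.mul_top]
  · obtain ⟨⟨F, hF⟩, hFe⟩ :=
      ENat.exists_eq_iInf fun F : {F : Set M // IsRescaledSpanning X t ε F} => F.1.encard
    rw [← hFe]
    refine numPeriodicOrbits_le_floor_mul_encard hX hη0 (le_of_lt hεpos) hC hδ hlip ?_ ?_ hF
    · have h1 : ε * C ≤ δ / 4 := by
        have := hε.le.trans (min_le_right _ _)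
        rw [le_div_iff₀ (by positivity)] at this
        linarith
      have h2 : C * η = δ / 2 := by rw [hη]; field_simp
      linarith
    · intro x hx
      obtain ⟨r, hr⟩ := exists_flow_notMem hX hUinv hx
      exact ⟨r, (hε.le.trans (min_le_left _ _)).trans (hreg _ hr)⟩
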